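/- **Theorem (Riemannian SGD).** Let $M$ be a finite-dimensional smooth Riemannian manifold (Hausdorff and second countable) and let $\mathcal X\subseteq M$ be a geodesically convex set on which the inverse exponential map is well defined: any two points $x,y\in\mathcal X$ are joined by exactly one geodesic $\gamma:[0,1]\to\mathcal X$, and $\mathrm{Exp}_x^{-1}(y)=\dot\gamma(0)$. Accordingly $\mathrm{Exp}$ denotes the exponential map within $\mathcal X$: $y=\mathrm{Exp}_x(v)$ means that there is a geodesic $\gamma:[0,1]\to\mathcal X$ with $\gamma(0)=x$, $\dot\gamma(0)=v$ and $\gamma(1)=y$. Let $L>0$ and let $f:\mathcal X\to\mathbb R$ be geodesically $L$-smooth, i.e. $f$ is differentiable with gradient $\nabla f$ and $\|\nabla f(x)-\Gamma_y^x\nabla f(y)\|\le L\,\|\mathrm{Exp}_x^{-1}(y)\|$ for all $x,y\in\mathcal X$, where $\Gamma_y^x$ is parallel transport from $y$ to $x$ along the geodesic joining them. Let $x^*\in\mathcal X$ be a global minimizer of $f$ on $\mathcal X$. Let $\sigma>0$, let $T\ge 1$ be an integer, and let $x^0\in\mathcal X$ be a deterministic point; if $f(x^0)=f(x^*)$, assume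 that $x^0$ is an interior point of $\mathcal X$. Put $$c=\sqrt{\frac{2(f(x^0)-f(x^*))}{L\sigma^2}},\qquad \eta=\frac{c}{\sqrt T},$$ and let $x^1,\dots,x^T$ be $\mathcal X$-valued random points generated by $$x^{t+1}=\mathrm{Exp}_{x^t}\bigl(-\eta\,\nabla\tilde f(x^t;\xi_t)\bigr),\qquad 0\le t\le T-1 ,$$ almost surely, where $\nabla\tilde f(x;\xi)\in T_xM$ is a jointly measurable stochastic first-order oracle and the sample $\xi_t$, of a fixed law $P$, is independent of the past (the history $\mathcal F_t$, with respect to which $x^t$ is measurable). Suppose that at the iterates the oracle is unbiased with second moment at most $\sigma^2$: for all $t\le T-1$, almost surely, with $\xi\sim P$ independent of $x^t$, $$\mathbb E_\xi\bigl[\nabla\tilde f(x^t;\xi)\bigr]=\nabla f(x^t),\qquad \mathbb E_\xi\bigl[\|\nabla\tilde f(x^t;\xi)\|^2\bigr]\le\sigma^2 .$$ Then the expectations $\mathbb E[\|\nabla f(x^t)\|^2]$, $0\le t\le T-1$, are finite and $$\min_{0\le t\le T-1}\mathbb E\bigl[\|\nabla f(x^t)\|^2\bigr]\;\le\;\sigma\sqrt{\frac{2\,(f(x^0)-f(x^*))\,L}{T}}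 .$$ -/

import Mathlib

open Set MeasureTheory Bundle Manifold
open scoped ContDiff

noncomputable section RiemannianGeometry

variable {E : Type*} [NormedAddCommGroup E] [NormedSpace ℝ E]
  {M : Type*} [TopologicalSpace M] [ChartedSpace E M]

/-- The coordinates, in the chart at `p`, of a tangent vector `v` at `x`. -/
def chartVec (p x : M) (v : TangentSpace 𝓘(ℝ, E) x) : E :=
  mfderiv 𝓘(ℝ, E) 𝓘(ℝ, E) (chartAt E p) x v

/-- The velocity at time `t` of a curve on `[0, 1]` (one-sided at the two end points). -/
def velocity (γ : ℝ → M) (t : ℝ) : TangentSpace 𝓘(ℝ, E) (γ t) :=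
  mfderivWithin 𝓘(ℝ, ℝ) 𝓘(ℝ, E) γ (Icc 0 1) t (1 : ℝ)

variable [RiemannianBundle (fun x : M ↦ TangentSpace 𝓘(ℝ, E) x)]

/-- The Riemannian metric read in the chart at `p`: the bilinear form on `E` at the
coordinate point `u`. -/
def chartMetric (p : M) (u a b : E) : ℝ :=
  inner ℝ
    (mfderiv 𝓘(ℝ, E) 𝓘(ℝ, E) (chartAt E p).symm u a)
    (mfderiv 𝓘(ℝ, E) 𝓘(ℝ, E) (chartAt E p).symm u b)

/-- The Christoffel symbols of the first kind of the Levi-Civita connection in the chart at `p`,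
`Γ(a, b; z) = (∂_a g(b, z) + ∂_b g(a, z) - ∂_z g(a, b)) / 2`. -/
def christoffel (p : M) (u a b z : E) : ℝ :=
  (fderiv ℝ (fun w ↦ chartMetric p w b z) u a
    + fderiv ℝ (fun w ↦ chartMetric p w a z) u b
    - fderiv ℝ (fun w ↦ chartMetric p w a b) u z) / 2

/-- The vector field `V` along the curve `γ` on `[0, 1]` is parallel for the Levi-Civita
connection. In coordinates `c` of `γ` and `v` of `V` the equation is
`g(v', z) + Γ(c', v; z) = 0` for every `z`, that is `v' + Γ(c', v) = 0`, the index having been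
lowered with the metric. -/
def IsParallelAlong (γ : ℝ → M) (V : ∀ t : ℝ, TangentSpace 𝓘(ℝ, E) (γ t)) : Prop :=
  ∀ p : M, ∀ t ∈ Icc (0 : ℝ) 1, γ t ∈ (chartAt E p).source →
    DifferentiableWithinAt ℝ (fun s ↦ chartVec p (γ s) (V s)) (Icc 0 1) t ∧
    ∀ z : E,
      chartMetric p (chartAt E p (γ t))
          (derivWithin (fun s ↦ chartVec p (γ s) (V s)) (Icc 0 1) t) z
        + christoffel p (chartAt E p (γ t))
          (derivWithin (fun s ↦ chartAt E p (γ s)) (Icc 0 1) t)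
          (chartVec p (γ t) (V t)) z = 0

variable (E) in
/-- `γ : [0, 1] → M` is a geodesic: a smooth curve whose velocity is parallel along it. -/
def IsGeodesic (γ : ℝ → M) : Prop :=
  ContMDiffOn 𝓘(ℝ, ℝ) 𝓘(ℝ, E) ∞ γ (Icc 0 1) ∧ IsParallelAlong γ (velocity (E := E) γ)

variable (E) in
/-- `γ` is a geodesic all of whose points lie in `X`. -/
def IsGeodesicIn (X : Set M) (γ : ℝ → M) : Prop :=
  IsGeodesic E γ ∧ ∀ t ∈ Icc (0 : ℝ) 1, γ t ∈ X

/-- `y = Exp_x(v)`, the exponential map within `X`: there is a geodesic `γ` in `X` with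
`γ(0) = x`, `γ'(0) = v` and `γ(1) = y`. -/
def IsExp (X : Set M) (x : M) (v : TangentSpace 𝓘(ℝ, E) x) (y : M) : Prop :=
  ∃ γ : ℝ → M, IsGeodesicIn E X γ ∧
    (⟨γ 0, velocity γ 0⟩ : TangentBundle 𝓘(ℝ, E) M) = ⟨x, v⟩ ∧ γ 1 = y

variable (E) in
/-- `X` is geodesically convex and `Exp_x⁻¹(y)` is well defined for all `x, y ∈ X`: any two points
of `X` are joined by a geodesic in `X`, and by only one. (A geodesic is determined by its initial
point and velocity, so uniqueness is that of the initial velocity `v = Exp_x⁻¹(y)`.) -/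
def HasInverseExp (X : Set M) : Prop :=
  ∀ x ∈ X, ∀ y ∈ X, ∃! v : TangentSpace 𝓘(ℝ, E) x, IsExp X x v y

/-- The vector field `g` is the Riemannian gradient of `f` on `X`: at each `x ∈ X` the function
`f` restricted to `X` is differentiable with differential `⟨g x, ·⟩`. -/
def IsGradientOn (X : Set M) (f : M → ℝ) (g : ∀ x : M, TangentSpace 𝓘(ℝ, E) x) : Prop :=
  ∀ x ∈ X, HasMFDerivWithinAt 𝓘(ℝ, E) 𝓘(ℝ, ℝ) f X x (innerSL ℝ (g x))

/-- The vector field `g` is geodesically `L`-Lipschitz on `X`: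
`‖g(x) - Γ_y^x g(y)‖ ≤ L ‖Exp_x⁻¹(y)‖` for all `x, y ∈ X`. Here `x = γ 0` and `y = γ 1` are the end
points of a geodesic `γ` in `X`, so that `Exp_x⁻¹(y) = γ'(0)`, and `Γ_y^x g(y)` is the value at
`x` of the parallel field `V` along `γ` with value `g(y)` at `y`. -/
def IsGeodesicallyLipschitzOn (L : ℝ) (X : Set M) (g : ∀ x : M, TangentSpace 𝓘(ℝ, E) x) : Prop :=
  ∀ γ : ℝ → M, IsGeodesicIn E X γ →
    ∃ V : ∀ t : ℝ, TangentSpace 𝓘(ℝ, E) (γ t),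
      IsParallelAlong γ V ∧ V 1 = g (γ 1) ∧
        ‖g (γ 0) - V 0‖ ≤ L * ‖velocity (E := E) γ 0‖

/-- `f` is geodesically `L`-smooth on `X`, with gradient `g`: it is differentiable on `X` and its
gradient is geodesically `L`-Lipschitz. -/
def IsGeodesicallySmoothOn (L : ℝ) (X : Set M) (f : M → ℝ)
    (g : ∀ x : M, TangentSpace 𝓘(ℝ, E) x) : Prop :=
  IsGradientOn X f g ∧ IsGeodesicallyLipschitzOn L X g

end RiemannianGeometry

/-!
The theorem rests on the descent inequality `f y ≤ f x + ⟪grad x, v⟫ + L / 2 * ‖v‖ ^ 2` for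
`y = Exp_x(v)` (`IsGeodesicallySmoothOn.le_of_isExp`). Along the geodesic `γ` with initial velocity
`v` the derivative of `f ∘ γ` at `t` is `⟪grad (γ t), γ' t⟫`. The geodesic from `x` to `γ t` is `γ`
slowed down by the factor `t` (`IsGeodesicIn.comp_mul`); parallel transport along it preserves inner
products (`IsParallelAlong.inner_zero_eq_inner_one`) and carries velocities to velocities, so that
the geodesic Lipschitz condition bounds this derivative by `⟪grad x, v⟫ + t * L * ‖v‖ ^ 2`.
Integration over `[0, 1]` gives the inequality.

For the step `v = -η G(x t, ξ t)`, the sample `ξ t` being independent of `x t`, the mean of the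
linear term is `-η E‖grad (x t)‖ ^ 2` and that of the quadratic term is at most `L η² σ² / 2`
(`integral_comp_of_indepFun`, `moments_of_memLp_two`). These expectations make sense because
`(x, s) ↦ ⟪E G(x, ·), G(x, s)⟫` is jointly measurable, as one sees in countably many charts
(`measurable_inner_integral`). Summing over `t < T`, and using `f ≥ f xstar`, gives
`η T min ≤ (f x₀ - f xstar) + T L η² σ² / 2`, and the step size `η` makes both terms on the right
equal. When `f x₀ = f xstar` the step size is zero and the claim is that `grad x₀ = 0`, which is
Fermat's rule at an interior minimizer (`IsGradientOn.eq_zero_of_isMinOn`).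
-/

/-! ### The metric and tangent vectors in a chart -/

section ChartCalculus

variable {E : Type*} [NormedAddCommGroup E] [NormedSpace ℝ E]
  {M : Type*} [TopologicalSpace M] [ChartedSpace E M] [IsManifold 𝓘(ℝ, E) ∞ M]

/-- The coordinates `chartVec p` are those of the trivialization of the tangent bundle at `p`. -/
lemma trivializationAt_snd_eq_chartVec {p x : M} (hx : x ∈ (chartAt E p).source)
    (v : TangentSpace 𝓘(ℝ, E) x) :
    (trivializationAt E (TangentSpace 𝓘(ℝ, E)) p (⟨x, v⟩ : TangentBundle 𝓘(ℝ, E) M)).2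
      = chartVec p x v := by
  have h := TangentBundle.continuousLinearMapAt_trivializationAt (I := 𝓘(ℝ, E)) hx
  have h2 := congrArg (fun l : TangentSpace 𝓘(ℝ, E) x →L[ℝ] E ↦ l v) h
  rw [← Trivialization.continuousLinearMapAt_apply_of_mem ℝ
    (trivializationAt E (TangentSpace 𝓘(ℝ, E)) p) hx]
  exact h2

lemma chartVec_mfderiv_symm {p : M} {u : E} (hu : u ∈ (chartAt E p).target) (a : E) :
    chartVec p ((chartAt E p).symm u)
      (mfderiv 𝓘(ℝ, E) 𝓘(ℝ, E) (chartAt E p).symm u a) = a := by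
  have h := (mdifferentiable_chart (I := 𝓘(ℝ, E)) p).comp_symm_deriv hu
  exact congrArg (fun l : E →L[ℝ] E ↦ l a) h

lemma mfderiv_symm_chartVec {p x : M} (hx : x ∈ (chartAt E p).source)
    (v : TangentSpace 𝓘(ℝ, E) x) :
    mfderiv 𝓘(ℝ, E) 𝓘(ℝ, E) (chartAt E p).symm (chartAt E p x) (show E from chartVec p x v)
      = (show E from v) := by
  have h := (mdifferentiable_chart (I := 𝓘(ℝ, E)) p).symm_comp_deriv hx
  exact congrArg (fun l : E →L[ℝ] E ↦ l v) h

lemma contMDiffOn_mfderiv_symm (p : M) :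
    ContMDiffOn (𝓘(ℝ, E × E)) (𝓘(ℝ, E).prod 𝓘(ℝ, E)) ∞
      (fun q : E × E ↦ (⟨(chartAt E p).symm q.1,
        mfderiv 𝓘(ℝ, E) 𝓘(ℝ, E) (chartAt E p).symm q.1 q.2⟩ : TangentBundle 𝓘(ℝ, E) M))
      ((chartAt E p).target ×ˢ univ) := by
  have hm : MapsTo (fun q : E × E ↦ (⟨(chartAt E p).symm q.1,
        mfderiv 𝓘(ℝ, E) 𝓘(ℝ, E) (chartAt E p).symm q.1 q.2⟩ : TangentBundle 𝓘(ℝ, E) M))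
      ((chartAt E p).target ×ˢ univ)
      (trivializationAt E (TangentSpace 𝓘(ℝ, E)) p).source := by
    rintro ⟨u, a⟩ ⟨hu, -⟩
    simpa using (chartAt E p).map_target hu
  rw [Trivialization.contMDiffOn_iff hm]
  constructor
  · exact (contMDiffOn_chart_symm (I := 𝓘(ℝ, E))).comp contDiff_fst.contMDiff.contMDiffOn
      (fun q hq ↦ hq.1)
  · refine (contDiff_snd.contMDiff.contMDiffOn).congr ?_
    rintro ⟨u, a⟩ ⟨hu, -⟩
    rw [trivializationAt_snd_eq_chartVec ((chartAt E p).map_target hu)]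
    exact chartVec_mfderiv_symm hu a

variable [RiemannianBundle (fun x : M ↦ TangentSpace 𝓘(ℝ, E) x)]

omit [IsManifold 𝓘(ℝ, E) ∞ M] in
/-- All tangent spaces are the same type `E`, so that two vectors of `E` may be paired at either of
two equal points. -/
lemma inner_congr_point {x y : M} (h : x = y) (a b : E) :
    (inner ℝ (show TangentSpace 𝓘(ℝ, E) x from a) (show TangentSpace 𝓘(ℝ, E) x from b) : ℝ)
      = inner ℝ (show TangentSpace 𝓘(ℝ, E) y from a) (show TangentSpace 𝓘(ℝ, E) y from b) := by
  subst h; rfl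

lemma chartMetric_chartVec {p x : M} (hx : x ∈ (chartAt E p).source)
    (v w : TangentSpace 𝓘(ℝ, E) x) :
    chartMetric p (chartAt E p x) (chartVec p x v) (chartVec p x w) = inner ℝ v w := by
  have h := inner_congr_point ((chartAt E p).left_inv hx) (E := E) v w
  rw [← h]
  unfold chartMetric
  congr 1
  · exact mfderiv_symm_chartVec hx v
  · exact mfderiv_symm_chartVec hx w

variable [IsContMDiffRiemannianBundle 𝓘(ℝ, E) ∞ E (fun x : M ↦ TangentSpace 𝓘(ℝ, E) x)]

lemma contDiffOn_chartMetric (p : M) :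
    ContDiffOn ℝ ∞ (fun q : E × E × E ↦ chartMetric p q.1 q.2.1 q.2.2)
      ((chartAt E p).target ×ˢ univ) := by
  rw [← contMDiffOn_iff_contDiffOn]
  have h1 : ContMDiffOn 𝓘(ℝ, E × E × E) 𝓘(ℝ, E × E) ∞ (fun q : E × E × E ↦ (q.1, q.2.1))
      ((chartAt E p).target ×ˢ univ) :=
    (contDiff_fst.prodMk (contDiff_fst.comp contDiff_snd)).contMDiff.contMDiffOn
  have h2 : ContMDiffOn 𝓘(ℝ, E × E × E) 𝓘(ℝ, E × E) ∞ (fun q : E × E × E ↦ (q.1, q.2.2))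
      ((chartAt E p).target ×ˢ univ) :=
    (contDiff_fst.prodMk (contDiff_snd.comp contDiff_snd)).contMDiff.contMDiffOn
  exact ContMDiffOn.inner_bundle
    ((contMDiffOn_mfderiv_symm p).comp h1 (fun q hq ↦ ⟨hq.1, trivial⟩))
    ((contMDiffOn_mfderiv_symm p).comp h2 (fun q hq ↦ ⟨hq.1, trivial⟩))

end ChartCalculus

/-! ### Parallel transport, geodesics and the descent inequality -/

section Geodesics

variable {E : Type*} [NormedAddCommGroup E] [NormedSpace ℝ E]
  {M : Type*} [TopologicalSpace M] [ChartedSpace E M]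

section MetricAlgebra

variable [RiemannianBundle (fun x : M ↦ TangentSpace 𝓘(ℝ, E) x)]

lemma chartMetric_comm (p : M) (u a b : E) : chartMetric p u a b = chartMetric p u b a :=
  real_inner_comm _ _

lemma chartMetric_add_left (p : M) (u a a' b : E) :
    chartMetric p u (a + a') b = chartMetric p u a b + chartMetric p u a' b := by
  unfold chartMetric
  rw [← inner_add_left]
  congr 1
  exact map_add (mfderiv 𝓘(ℝ, E) 𝓘(ℝ, E) (chartAt E p).symm u) _ _

lemma chartMetric_smul_left (p : M) (u : E) (r : ℝ) (a b : E) :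
    chartMetric p u (r • a) b = r * chartMetric p u a b := by
  unfold chartMetric
  rw [← real_inner_smul_left]
  congr 1
  exact map_smul (mfderiv 𝓘(ℝ, E) 𝓘(ℝ, E) (chartAt E p).symm u) _ _

lemma chartMetric_smul_right (p : M) (u : E) (r : ℝ) (a b : E) :
    chartMetric p u a (r • b) = r * chartMetric p u a b := by
  rw [chartMetric_comm, chartMetric_smul_left, chartMetric_comm]

/-- The Christoffel symbols, symmetrized in the last two slots, are a derivative of the metric. -/
lemma christoffel_add_christoffel (p : M) (u a b z : E) :
    christoffel p u a b z + christoffel p u a z b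
      = fderiv ℝ (fun w ↦ chartMetric p w b z) u a := by
  unfold christoffel
  simp only [chartMetric_comm p _ z b]
  ring

lemma christoffel_smul_smul (p : M) (u : E) (r : ℝ) (a b z : E) :
    christoffel p u (r • a) (r • b) z = r ^ 2 * christoffel p u a b z := by
  have hk (k : ℝ) (F : E → ℝ) (d : E) :
      fderiv ℝ (fun w ↦ k * F w) u d = k * fderiv ℝ F u d :=
    congrArg (fun l : E → E →L[ℝ] ℝ ↦ l u d) (fderiv_const_smul_field (f := F) k)
  unfold christoffel
  simp only [chartMetric_smul_left, chartMetric_smul_right, map_smul, smul_eq_mul, hk]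
  ring

end MetricAlgebra

variable [IsManifold 𝓘(ℝ, E) ∞ M]

lemma hasDerivWithinAt_chartAt_comp {γ : ℝ → M} {t : ℝ} {p : M}
    (hγ : MDifferentiableWithinAt 𝓘(ℝ, ℝ) 𝓘(ℝ, E) γ (Icc 0 1) t)
    (hp : γ t ∈ (chartAt E p).source) :
    HasDerivWithinAt (fun s ↦ chartAt E p (γ s)) (chartVec p (γ t) (velocity γ t)) (Icc 0 1) t := by
  have h1 := ((mdifferentiable_chart (I := 𝓘(ℝ, E)) p).mdifferentiableAt hp).hasMFDerivAt
  have h2 : HasFDerivWithinAt (fun s ↦ chartAt E p (γ s)) (show ℝ →L[ℝ] E from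
      (mfderiv 𝓘(ℝ, E) 𝓘(ℝ, E) (chartAt E p) (γ t)).comp
        (mfderivWithin 𝓘(ℝ, ℝ) 𝓘(ℝ, E) γ (Icc 0 1) t)) (Icc 0 1) t :=
    (h1.comp_hasMFDerivWithinAt t hγ.hasMFDerivWithinAt).hasFDerivWithinAt
  exact h2.hasDerivWithinAt

lemma derivWithin_chartAt_comp {γ : ℝ → M} {t : ℝ} (ht : t ∈ Icc (0 : ℝ) 1) {p : M}
    (hγ : MDifferentiableWithinAt 𝓘(ℝ, ℝ) 𝓘(ℝ, E) γ (Icc 0 1) t)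
    (hp : γ t ∈ (chartAt E p).source) :
    derivWithin (fun s ↦ chartAt E p (γ s)) (Icc 0 1) t = chartVec p (γ t) (velocity γ t) :=
  (hasDerivWithinAt_chartAt_comp hγ hp).derivWithin (uniqueDiffOn_Icc_zero_one t ht)

omit [IsManifold 𝓘(ℝ, E) ∞ M] in
lemma velocity_comp_mul {γ : ℝ → M} (hγ : MDifferentiableOn 𝓘(ℝ, ℝ) 𝓘(ℝ, E) γ (Icc 0 1))
    {r : ℝ} (hr : r ∈ Icc (0 : ℝ) 1) {s : ℝ} (hs : s ∈ Icc (0 : ℝ) 1) :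
    velocity (E := E) (fun s ↦ γ (r * s)) s = r • velocity (E := E) γ (r * s) := by
  have hmaps : MapsTo (fun s : ℝ ↦ r * s) (Icc 0 1) (Icc 0 1) := fun s hs ↦
    ⟨mul_nonneg hr.1 hs.1, mul_le_one₀ hr.2 hs.1 hs.2⟩
  have h1 := (hγ _ (hmaps hs)).hasMFDerivWithinAt
  have h2 : HasMFDerivWithinAt 𝓘(ℝ, ℝ) 𝓘(ℝ, ℝ) (fun s : ℝ ↦ r * s) (Icc 0 1) s
      (ContinuousLinearMap.toSpanSingleton ℝ r) := by
    have h : HasDerivAt (fun s : ℝ ↦ r * s) r s := by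
      simpa using (hasDerivAt_id s).const_mul r
    exact h.hasDerivWithinAt.hasFDerivWithinAt.hasMFDerivWithinAt
  have h3 := (h1.comp s h2 hmaps).mfderivWithin
    (uniqueMDiffOn_iff_uniqueDiffOn.2 uniqueDiffOn_Icc_zero_one s hs)
  have h4 := congrArg (fun l : ℝ →L[ℝ] E ↦ l 1) h3
  refine h4.trans ?_
  have h5 := (mfderivWithin 𝓘(ℝ, ℝ) 𝓘(ℝ, E) γ (Icc 0 1) (r * s)).map_smul r (1 : ℝ)
  refine Eq.trans ?_ h5
  show (mfderivWithin 𝓘(ℝ, ℝ) 𝓘(ℝ, E) γ (Icc 0 1) (r * s)) ((1 : ℝ) • r) = _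
  congr 1
  show (1 : ℝ) * r = r * 1
  ring

omit [IsManifold 𝓘(ℝ, E) ∞ M] in
lemma chartVec_smul (p x : M) (r : ℝ) (v : TangentSpace 𝓘(ℝ, E) x) :
    chartVec p x (r • v) = r • chartVec p x v :=
  map_smul (mfderiv 𝓘(ℝ, E) 𝓘(ℝ, E) (chartAt E p) x) r v

variable [RiemannianBundle (fun x : M ↦ TangentSpace 𝓘(ℝ, E) x)]

/-- A geodesic run at a constant fraction `r` of its speed is a geodesic: both terms of the
geodesic equation are homogeneous of degree two in the velocity. -/
lemma IsGeodesicIn.comp_mul {X : Set M} {γ : ℝ → M} (hγ : IsGeodesicIn E X γ)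
    {r : ℝ} (hr : r ∈ Icc (0 : ℝ) 1) : IsGeodesicIn E X (fun s ↦ γ (r * s)) := by
  have hmaps : MapsTo (fun s : ℝ ↦ r * s) (Icc 0 1) (Icc 0 1) := fun s hs ↦
    ⟨mul_nonneg hr.1 hs.1, mul_le_one₀ hr.2 hs.1 hs.2⟩
  obtain ⟨⟨hsm, hpar⟩, hin⟩ := hγ
  have hmd : MDifferentiableOn 𝓘(ℝ, ℝ) 𝓘(ℝ, E) γ (Icc 0 1) :=
    hsm.mdifferentiableOn (by simp)
  have hsm' : ContMDiffOn 𝓘(ℝ, ℝ) 𝓘(ℝ, E) ∞ (fun s ↦ γ (r * s)) (Icc 0 1) :=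
    hsm.comp ((contDiff_const.mul contDiff_id).contMDiff.contMDiffOn) hmaps
  have hmd' : MDifferentiableOn 𝓘(ℝ, ℝ) 𝓘(ℝ, E) (fun s ↦ γ (r * s)) (Icc 0 1) :=
    hsm'.mdifferentiableOn (by simp)
  refine ⟨⟨hsm', ?_⟩, fun t ht ↦ hin _ (hmaps ht)⟩
  intro p t ht hp
  obtain ⟨hd, heq⟩ := hpar p (r * t) (hmaps ht) hp
  have hmul : HasDerivWithinAt (fun s : ℝ ↦ r * s) r (Icc 0 1) t := by
    simpa using ((hasDerivAt_id t).const_mul r).hasDerivWithinAt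
  have hD : HasDerivWithinAt
      (fun s ↦ chartVec p (γ (r * s)) (velocity (E := E) (fun s ↦ γ (r * s)) s))
      (r • r • derivWithin (fun s ↦ chartVec p (γ s) (velocity γ s)) (Icc 0 1) (r * t))
      (Icc 0 1) t := by
    have h := (hd.hasDerivWithinAt.scomp t hmul hmaps).const_smul r
    refine h.congr_of_mem (fun s hs ↦ ?_) ht
    rw [velocity_comp_mul hmd hr hs, chartVec_smul]
    rfl
  refine ⟨hD.differentiableWithinAt, fun z ↦ ?_⟩
  have heq := heq z
  rw [derivWithin_chartAt_comp (hmaps ht) (hmd _ (hmaps ht)) hp] at heq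
  rw [hD.derivWithin (uniqueDiffOn_Icc_zero_one t ht),
    derivWithin_chartAt_comp ht (hmd' _ ht) hp, velocity_comp_mul hmd hr ht, chartVec_smul,
    christoffel_smul_smul, chartMetric_smul_left, chartMetric_smul_left]
  linear_combination r ^ 2 * heq

variable [IsContMDiffRiemannianBundle 𝓘(ℝ, E) ∞ E (fun x : M ↦ TangentSpace 𝓘(ℝ, E) x)]

/-- The product rule for the metric in a chart, along curves of base points and of vectors. -/
lemma hasDerivWithinAt_chartMetric {p : M} {c v w : ℝ → E} {c' v' w' : E} {s : Set ℝ} {t : ℝ}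
    (hc : HasDerivWithinAt c c' s t) (hv : HasDerivWithinAt v v' s t)
    (hw : HasDerivWithinAt w w' s t) (hp : c t ∈ (chartAt E p).target) :
    HasDerivWithinAt (fun r ↦ chartMetric p (c r) (v r) (w r))
      (fderiv ℝ (fun u ↦ chartMetric p u (v t) (w t)) (c t) c'
        + chartMetric p (c t) v' (w t) + chartMetric p (c t) (v t) w') s t := by
  set F : E × E × E → ℝ := fun q ↦ chartMetric p q.1 q.2.1 q.2.2 with hF
  have hopen : IsOpen ((chartAt E p).target ×ˢ (univ : Set (E × E))) :=
    (chartAt E p).open_target.prod isOpen_univ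
  have hdiff : HasFDerivAt F (fderiv ℝ F (c t, v t, w t)) (c t, v t, w t) :=
    (((contDiffOn_chartMetric p).contDiffAt (hopen.mem_nhds ⟨hp, trivial⟩)).differentiableAt
      (by simp)).hasFDerivAt
  have hcurve := hdiff.comp_hasDerivWithinAt t (hc.prodMk (hv.prodMk hw))
  refine hcurve.congr_deriv ?_
  -- split the total derivative into its three partial derivatives; the last two are of linear maps
  have e : ((c', v', w') : E × E × E) = (c', 0, 0) + ((0, v', 0) + (0, 0, w')) := by simp
  rw [e, map_add, map_add, ← add_assoc]
  congr 1
  · congr 1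
    · have h : HasFDerivAt (fun u : E ↦ ((u, v t, w t) : E × E × E))
          ((ContinuousLinearMap.id ℝ E).prod 0) (c t) :=
        (hasFDerivAt_id _).prodMk (hasFDerivAt_const _ _)
      have h2 := (hdiff.comp (c t) h).fderiv
      have h3 := congrArg (fun l : E →L[ℝ] ℝ ↦ l c') h2
      exact h3.symm
    · have h : HasDerivAt (fun r : ℝ ↦ ((c t, v t + r • v', w t) : E × E × E)) (0, v', 0) 0 := by
        have := ((hasDerivAt_id (0 : ℝ)).smul_const v').const_add (v t)
        rw [one_smul] at this
        exact (hasDerivAt_const _ _).prodMk (this.prodMk (hasDerivAt_const _ _))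
      have h2 := HasFDerivAt.comp_hasDerivAt (0 : ℝ)
        (f := fun r : ℝ ↦ ((c t, v t + r • v', w t) : E × E × E)) (by simpa using hdiff) h
      have h3 : HasDerivAt (F ∘ fun r : ℝ ↦ ((c t, v t + r • v', w t) : E × E × E))
          (chartMetric p (c t) v' (w t)) 0 := by
        have : (F ∘ fun r : ℝ ↦ ((c t, v t + r • v', w t) : E × E × E)) = fun r ↦
            chartMetric p (c t) (v t) (w t) + r * chartMetric p (c t) v' (w t) := by
          funext r
          simp [hF, chartMetric_add_left, chartMetric_smul_left]
        rw [this]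
        simpa using ((hasDerivAt_id (0 : ℝ)).mul_const
          (chartMetric p (c t) v' (w t))).const_add (chartMetric p (c t) (v t) (w t))
      exact h2.unique h3
  · have h : HasDerivAt (fun r : ℝ ↦ ((c t, v t, w t + r • w') : E × E × E)) (0, 0, w') 0 := by
      have := ((hasDerivAt_id (0 : ℝ)).smul_const w').const_add (w t)
      rw [one_smul] at this
      exact (hasDerivAt_const _ _).prodMk ((hasDerivAt_const _ _).prodMk this)
    have h2 := HasFDerivAt.comp_hasDerivAt (0 : ℝ)
      (f := fun r : ℝ ↦ ((c t, v t, w t + r • w') : E × E × E)) (by simpa using hdiff) h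
    have h3 : HasDerivAt (F ∘ fun r : ℝ ↦ ((c t, v t, w t + r • w') : E × E × E))
        (chartMetric p (c t) (v t) w') 0 := by
      have : (F ∘ fun r : ℝ ↦ ((c t, v t, w t + r • w') : E × E × E)) = fun r ↦
          chartMetric p (c t) (v t) (w t) + r * chartMetric p (c t) (v t) w' := by
        funext r
        simp only [hF, Function.comp_apply]
        rw [chartMetric_comm, chartMetric_add_left, chartMetric_smul_left,
          chartMetric_comm p _ (w t), chartMetric_comm p _ w']
      rw [this]
      simpa using ((hasDerivAt_id (0 : ℝ)).mul_const
        (chartMetric p (c t) (v t) w')).const_add (chartMetric p (c t) (v t) (w t))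
    exact h2.unique h3

/-- Metric compatibility of the Levi-Civita connection: in a chart, the derivative of the metric
along the curve cancels the two Christoffel terms. -/
lemma IsParallelAlong.hasDerivWithinAt_inner {γ : ℝ → M}
    (hγ : MDifferentiableOn 𝓘(ℝ, ℝ) 𝓘(ℝ, E) γ (Icc 0 1))
    {V W : ∀ t : ℝ, TangentSpace 𝓘(ℝ, E) (γ t)}
    (hV : IsParallelAlong γ V) (hW : IsParallelAlong γ W) {t : ℝ} (ht : t ∈ Icc (0 : ℝ) 1) :
    HasDerivWithinAt (fun s ↦ inner ℝ (V s) (W s)) 0 (Icc 0 1) t := by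
  set p := γ t with hpdef
  have hp : γ t ∈ (chartAt E p).source := mem_chart_source E p
  obtain ⟨hVd, hVe⟩ := hV p t ht hp
  obtain ⟨hWd, hWe⟩ := hW p t ht hp
  have hc := hasDerivWithinAt_chartAt_comp (hγ t ht) hp
  have hmain := hasDerivWithinAt_chartMetric (p := p) hc hVd.hasDerivWithinAt
    hWd.hasDerivWithinAt ((chartAt E p).map_source hp)
  have h0 : fderiv ℝ (fun u ↦ chartMetric p u (chartVec p (γ t) (V t)) (chartVec p (γ t) (W t)))
        (chartAt E p (γ t)) (chartVec p (γ t) (velocity γ t))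
      + chartMetric p (chartAt E p (γ t))
        (derivWithin (fun s ↦ chartVec p (γ s) (V s)) (Icc 0 1) t) (chartVec p (γ t) (W t))
      + chartMetric p (chartAt E p (γ t)) (chartVec p (γ t) (V t))
        (derivWithin (fun s ↦ chartVec p (γ s) (W s)) (Icc 0 1) t) = 0 := by
    have e1 := hVe (chartVec p (γ t) (W t))
    have e2 := hWe (chartVec p (γ t) (V t))
    rw [hc.derivWithin (uniqueDiffOn_Icc_zero_one t ht)] at e1 e2
    rw [← christoffel_add_christoffel, chartMetric_comm p _ (chartVec p (γ t) (V t))]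
    linear_combination e1 + e2
  rw [h0] at hmain
  refine hmain.congr_of_eventuallyEq ?_ (chartMetric_chartVec hp (V t) (W t)).symm
  have hnhds : ∀ᶠ s in nhdsWithin t (Icc 0 1), γ s ∈ (chartAt E p).source :=
    (hγ t ht).continuousWithinAt.eventually ((chartAt E p).open_source.mem_nhds hp)
  filter_upwards [hnhds] with s hs
  exact (chartMetric_chartVec hs (V s) (W s)).symm

/-- Parallel transport is an isometry. -/
lemma IsParallelAlong.inner_zero_eq_inner_one {γ : ℝ → M}
    (hγ : MDifferentiableOn 𝓘(ℝ, ℝ) 𝓘(ℝ, E) γ (Icc 0 1))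
    {V W : ∀ t : ℝ, TangentSpace 𝓘(ℝ, E) (γ t)}
    (hV : IsParallelAlong γ V) (hW : IsParallelAlong γ W) :
    (inner ℝ (V 0) (W 0) : ℝ) = inner ℝ (V 1) (W 1) := by
  have hder : ∀ t ∈ Icc (0 : ℝ) 1, HasDerivWithinAt (fun s ↦ (inner ℝ (V s) (W s) : ℝ)) 0
      (Icc 0 1) t := fun t ht ↦ hV.hasDerivWithinAt_inner hγ hW ht
  exact (convex_Icc (0 : ℝ) 1).is_const_of_fderivWithin_eq_zero (𝕜 := ℝ)
    (f := fun s ↦ (inner ℝ (V s) (W s) : ℝ))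
    (fun t ht ↦ (hder t ht).differentiableWithinAt)
    (fun t ht ↦ by
      rw [(hder t ht).hasFDerivWithinAt.fderivWithin (uniqueDiffOn_Icc_zero_one t ht)]
      ext; simp)
    (left_mem_Icc.2 zero_le_one) (right_mem_Icc.2 zero_le_one)

/-- The descent inequality, integrated along a geodesic. The gradient at `γ t` is compared with
the one at `γ 0` by parallel transport along the geodesic from `γ 0` to `γ t`. -/
lemma IsGeodesicallySmoothOn.le_along_geodesic {X : Set M} {f : M → ℝ}
    {g : ∀ x : M, TangentSpace 𝓘(ℝ, E) x} {L : ℝ} (hf : IsGeodesicallySmoothOn L X f g)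
    {γ : ℝ → M} (hγ : IsGeodesicIn E X γ) :
    f (γ 1) ≤ f (γ 0) + inner ℝ (g (γ 0)) (velocity γ 0)
      + L / 2 * ‖velocity (E := E) γ 0‖ ^ 2 := by
  have hmd : MDifferentiableOn 𝓘(ℝ, ℝ) 𝓘(ℝ, E) γ (Icc 0 1) :=
    hγ.1.1.mdifferentiableOn (by simp)
  set A : ℝ → ℝ := fun t ↦ inner ℝ (g (γ t)) (velocity γ t) with hA
  set N : ℝ → ℝ := fun t ↦ ‖velocity (E := E) γ t‖ with hN
  have hder : ∀ t ∈ Icc (0 : ℝ) 1, HasDerivWithinAt (fun s ↦ f (γ s)) (A t) (Icc 0 1) t := by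
    intro t ht
    have h1 := hf.1 (γ t) (hγ.2 t ht)
    have h2 : HasFDerivWithinAt (fun s ↦ f (γ s)) (show ℝ →L[ℝ] ℝ from
        (innerSL ℝ (g (γ t))).comp (mfderivWithin 𝓘(ℝ, ℝ) 𝓘(ℝ, E) γ (Icc 0 1) t)) (Icc 0 1) t :=
      (h1.comp t (hmd t ht).hasMFDerivWithinAt (fun s hs ↦ hγ.2 s hs)).hasFDerivWithinAt
    exact h2.hasDerivWithinAt
  have hbound : ∀ t ∈ Ioo (0 : ℝ) 1, A t ≤ A 0 + L * N 0 ^ 2 * t := by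
    intro t ht
    have ht' : t ∈ Icc (0 : ℝ) 1 := ⟨ht.1.le, ht.2.le⟩
    have hγt := hγ.comp_mul ht'
    obtain ⟨V, hV, hV1, hVL⟩ := hf.2 _ hγt
    have hc := IsParallelAlong.inner_zero_eq_inner_one
      (hγt.1.1.mdifferentiableOn (by simp)) hV hγt.1.2
    rw [hV1] at hc
    -- `V` is parallel and `V 1` is the gradient, hence the pairing of `V 0` with the velocity
    -- at `γ 0` is that of the gradient with the velocity at `γ t`
    have hcs := real_inner_le_norm (V 0 - g (γ (t * 0)))
      (velocity (E := E) (fun s ↦ γ (t * s)) 0)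
    rw [inner_sub_left, hc, norm_sub_rev] at hcs
    have hcs' := hcs.trans (mul_le_mul_of_nonneg_right hVL (norm_nonneg _))
    rw [velocity_comp_mul hmd ht' (left_mem_Icc.2 zero_le_one),
      velocity_comp_mul hmd ht' (right_mem_Icc.2 zero_le_one), norm_smul,
      real_inner_smul_right, real_inner_smul_right, Real.norm_of_nonneg ht.1.le] at hcs'
    change t * A (t * 1) - t * A (t * 0) ≤ L * (t * N (t * 0)) * (t * N (t * 0)) at hcs'
    rw [mul_one, mul_zero] at hcs'
    have : t * A t ≤ t * (A 0 + L * N 0 ^ 2 * t) := by linarith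
    exact le_of_mul_le_mul_left this ht.1
  have hanti : AntitoneOn (fun t ↦ f (γ t) - (A 0 * t + L / 2 * N 0 ^ 2 * t ^ 2)) (Icc 0 1) := by
    have hpoly : ∀ t : ℝ, HasDerivAt (fun t : ℝ ↦ A 0 * t + L / 2 * N 0 ^ 2 * t ^ 2)
        (A 0 + L * N 0 ^ 2 * t) t := fun t ↦ by
      have := ((hasDerivAt_id t).const_mul (A 0)).add
        (((hasDerivAt_id t).pow 2).const_mul (L / 2 * N 0 ^ 2))
      refine this.congr_deriv ?_
      simp
      ring
    refine antitoneOn_of_hasDerivWithinAt_nonpos (convex_Icc 0 1)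
      (f' := fun t ↦ A t - (A 0 + L * N 0 ^ 2 * t))
      (fun t ht ↦ ((hder t ht).sub (hpoly t).hasDerivWithinAt).continuousWithinAt) ?_ ?_
    · intro t ht
      have ht' := interior_subset ht
      exact ((hder t ht').sub (hpoly t).hasDerivWithinAt).mono interior_subset
    · intro t ht
      rw [interior_Icc] at ht
      linarith [hbound t ht]
  have h01 := hanti (left_mem_Icc.2 zero_le_one) (right_mem_Icc.2 zero_le_one) zero_le_one
  change f (γ 1) - (A 0 * 1 + L / 2 * N 0 ^ 2 * 1 ^ 2)
    ≤ f (γ 0) - (A 0 * 0 + L / 2 * N 0 ^ 2 * 0 ^ 2) at h01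
  change f (γ 1) ≤ f (γ 0) + A 0 + L / 2 * N 0 ^ 2
  linarith

/-- The descent inequality for a step of the exponential map. -/
lemma IsGeodesicallySmoothOn.le_of_isExp {X : Set M} {f : M → ℝ}
    {g : ∀ x : M, TangentSpace 𝓘(ℝ, E) x} {L : ℝ} (hf : IsGeodesicallySmoothOn L X f g)
    {x y : M} {v : TangentSpace 𝓘(ℝ, E) x} (h : IsExp X x v y) :
    f y ≤ f x + inner ℝ (g x) v + L / 2 * ‖v‖ ^ 2 := by
  obtain ⟨γ, hγ, h0, rfl⟩ := h
  have hle := hf.le_along_geodesic hγ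
  have e := congrArg (fun q : TangentBundle 𝓘(ℝ, E) M ↦
    f q.1 + (inner ℝ (g q.1) q.2 : ℝ) + L / 2 * ‖q.2‖ ^ 2) h0
  exact hle.trans_eq e

end Geodesics

/-! ### Fermat's rule -/

section CriticalPoint

variable {E : Type*} [NormedAddCommGroup E] [NormedSpace ℝ E]
  {M : Type*} [TopologicalSpace M] [ChartedSpace E M]
  [RiemannianBundle (fun x : M ↦ TangentSpace 𝓘(ℝ, E) x)]

/-- Fermat's rule on a Riemannian manifold. -/
lemma IsGradientOn.eq_zero_of_isMinOn {X : Set M} {f : M → ℝ}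
    {g : ∀ x : M, TangentSpace 𝓘(ℝ, E) x} (hf : IsGradientOn X f g) {x : M}
    (hx : x ∈ interior X) (hmin : IsMinOn f X x) : g x = 0 := by
  have hX : X ∈ nhds x := mem_interior_iff_mem_nhds.1 hx
  have hD := (hf x (interior_subset hx)).hasMFDerivAt hX
  have hloc : IsLocalMin f ((extChartAt 𝓘(ℝ, E) x).symm (extChartAt 𝓘(ℝ, E) x x)) := by
    rw [extChartAt_to_inv]
    exact hmin.isLocalMin hX
  have hloc' : IsLocalMin (f ∘ (extChartAt 𝓘(ℝ, E) x).symm) (extChartAt 𝓘(ℝ, E) x x) :=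
    IsMinFilter.comp_tendsto hloc (continuousAt_extChartAt_symm x)
  have hfd : HasFDerivAt (f ∘ (extChartAt 𝓘(ℝ, E) x).symm) (show E →L[ℝ] ℝ from innerSL ℝ (g x))
      (extChartAt 𝓘(ℝ, E) x x) := by
    rw [← hasFDerivWithinAt_univ, ← ModelWithCorners.range_eq_univ 𝓘(ℝ, E)]
    exact hD.2
  have h0 : (inner ℝ (g x) (g x) : ℝ) = 0 :=
    congrArg (fun l : E →L[ℝ] ℝ ↦ l (g x)) (hloc'.hasFDerivAt_eq_zero hfd)
  exact inner_self_eq_zero.1 h0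

end CriticalPoint

/-! ### Measurability of random tangent fields -/

section Measurability

variable {E : Type*} [NormedAddCommGroup E] [NormedSpace ℝ E] [FiniteDimensional ℝ E]
  {M : Type*} [TopologicalSpace M] [SecondCountableTopology M]
  [ChartedSpace E M] [IsManifold 𝓘(ℝ, E) ∞ M]
  [RiemannianBundle (fun x : M ↦ TangentSpace 𝓘(ℝ, E) x)]
  [IsContMDiffRiemannianBundle 𝓘(ℝ, E) ∞ E (fun x : M ↦ TangentSpace 𝓘(ℝ, E) x)]

omit [FiniteDimensional ℝ E] [SecondCountableTopology M] in
lemma continuous_norm_sq_tangentBundle :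
    Continuous (fun q : TangentBundle 𝓘(ℝ, E) M ↦ ‖q.2‖ ^ 2) := by
  have hid : ContMDiff (𝓘(ℝ, E).prod 𝓘(ℝ, E)) (𝓘(ℝ, E).prod 𝓘(ℝ, E)) ∞
      (fun q : TangentBundle 𝓘(ℝ, E) M ↦ (⟨q.1, q.2⟩ : TangentBundle 𝓘(ℝ, E) M)) := contMDiff_id
  have h : ContMDiff (𝓘(ℝ, E).prod 𝓘(ℝ, E)) 𝓘(ℝ, ℝ) ∞
      (fun q : TangentBundle 𝓘(ℝ, E) M ↦ (inner ℝ q.2 q.2 : ℝ)) :=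
    ContMDiff.inner_bundle hid hid
  simpa only [real_inner_self_eq_norm_sq] using h.continuous

omit [FiniteDimensional ℝ E] [SecondCountableTopology M] in
lemma measurable_norm_sq_tangentBundle :
    Measurable[borel (TangentBundle 𝓘(ℝ, E) M)]
      (fun q : TangentBundle 𝓘(ℝ, E) M ↦ ‖q.2‖ ^ 2) := by
  borelize (TangentBundle 𝓘(ℝ, E) M)
  exact continuous_norm_sq_tangentBundle.measurable

omit [SecondCountableTopology M] [FiniteDimensional ℝ E]
  [IsContMDiffRiemannianBundle 𝓘(ℝ, E) ∞ E (fun x : M ↦ TangentSpace 𝓘(ℝ, E) x)] in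
/-- The integral in a tangent space is taken with the Riemannian norm, the one of coordinates with
the norm of `E`; the coordinate map is a linear homeomorphism, and so exchanges them. -/
lemma chartVec_integral {S : Type*} [MeasurableSpace S] (P : Measure S)
    {p x : M} (hx : x ∈ (chartAt E p).source) (v : S → TangentSpace 𝓘(ℝ, E) x) :
    chartVec p x (∫ s, v s ∂P) = ∫ s, chartVec p x (v s) ∂P := by
  let l : TangentSpace 𝓘(ℝ, E) x ≃L[ℝ] E :=
    (mdifferentiable_chart (I := 𝓘(ℝ, E)) p).mfderiv hx
  exact (l.integral_comp_comm v).symm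

omit [FiniteDimensional ℝ E] [SecondCountableTopology M] in
lemma measurable_norm_sq_of_measurable_tangentBundle {A : Type*} [MeasurableSpace A] {x : A → M}
    {v : ∀ a, TangentSpace 𝓘(ℝ, E) (x a)}
    (hv : Measurable[_, borel (TangentBundle 𝓘(ℝ, E) M)]
      (fun a ↦ (⟨x a, v a⟩ : TangentBundle 𝓘(ℝ, E) M))) :
    Measurable (fun a ↦ ‖v a‖ ^ 2) := by
  have h := measurable_norm_sq_tangentBundle (E := E) (M := M)
  have h2 := h.comp hv
  exact h2

/-- Pairing a measurable random field with its mean field is measurable.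
In the chart at `p` the mean field has the coordinates `∫ s, chartVec p x (G x s) ∂P`, which
are measurable in `x`; countably many charts cover the manifold. -/
lemma measurable_inner_integral [MeasurableSpace M] [BorelSpace M] {X : Set M}
    {S : Type*} [MeasurableSpace S] (P : Measure S) [SFinite P]
    (G : ∀ x : M, S → TangentSpace 𝓘(ℝ, E) x)
    (hG : Measurable[_, borel (TangentBundle 𝓘(ℝ, E) M)]
      (fun q : X × S ↦ (⟨(q.1 : M), G q.1 q.2⟩ : TangentBundle 𝓘(ℝ, E) M))) :
    Measurable (fun q : X × S ↦ (inner ℝ (∫ s, G q.1 s ∂P) (G q.1 q.2) : ℝ)) := by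
  classical
  borelize E (TangentBundle 𝓘(ℝ, E) M)
  have : ProperSpace E := FiniteDimensional.proper_real E
  set φ : X × S → ℝ := fun q ↦ inner ℝ (∫ s, G q.1 s ∂P) (G q.1 q.2) with hφ
  -- over the domain of the chart at `p`, `φ` agrees with its coordinate expression, extended by `0`
  have hlocal : ∀ p : M, ∃ ψ : X × S → ℝ, Measurable ψ ∧
      ∀ q : X × S, (q.1 : M) ∈ (chartAt E p).source → φ q = ψ q := by
    intro p
    set τ := trivializationAt E (TangentSpace 𝓘(ℝ, E) : M → Type _) p
    have hvec : Measurable (τ.source.piecewise (fun q ↦ (τ q).2) (fun _ ↦ (0 : E))) :=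
      (continuous_snd.comp_continuousOn τ.continuousOn).measurable_piecewise
        continuousOn_const τ.open_source.measurableSet
    set c : X × S → E := fun q ↦ τ.source.piecewise (fun q ↦ (τ q).2) (fun _ ↦ (0 : E))
      (⟨(q.1 : M), G q.1 q.2⟩ : TangentBundle 𝓘(ℝ, E) M) with hcdef
    have hc : Measurable c := hvec.comp hG
    have hc_eq : ∀ q : X × S, (q.1 : M) ∈ (chartAt E p).source →
        c q = chartVec p (q.1 : M) (G q.1 q.2) := by
      intro q hq
      rw [← trivializationAt_snd_eq_chartVec hq]
      exact piecewise_eq_of_mem _ _ _ (by simpa [τ] using hq)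
    have hm : Measurable (fun x : X ↦ ∫ s, c (x, s) ∂P) :=
      hc.stronglyMeasurable.integral_prod_right'.measurable
    have hK : Measurable (((chartAt E p).source ×ˢ (univ : Set (E × E))).piecewise
        (fun q : M × E × E ↦ chartMetric p (chartAt E p q.1) q.2.1 q.2.2) (fun _ ↦ (0 : ℝ))) := by
      refine ContinuousOn.measurable_piecewise ?_ continuousOn_const
        ((chartAt E p).open_source.prod isOpen_univ).measurableSet
      have h1 : ContinuousOn (fun q : M × E × E ↦ (chartAt E p q.1, q.2))
          ((chartAt E p).source ×ˢ univ) :=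
        ((chartAt E p).continuousOn.comp continuousOn_fst (fun q hq ↦ hq.1)).prodMk
          continuousOn_snd
      exact (contDiffOn_chartMetric p).continuousOn.comp h1
        (fun q hq ↦ ⟨(chartAt E p).map_source hq.1, trivial⟩)
    refine ⟨_, hK.comp ((measurable_subtype_coe.comp measurable_fst).prodMk
      ((hm.comp measurable_fst).prodMk hc)), fun q hq ↦ ?_⟩
    simp only [Function.comp_apply]
    rw [piecewise_eq_of_mem _ _ _ (mk_mem_prod hq (mem_univ _)), hc_eq q hq]
    have hint : ∫ s, c (q.1, s) ∂P = chartVec p (q.1 : M) (∫ s, G q.1 s ∂P) := by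
      rw [chartVec_integral P hq]
      exact integral_congr_ae (.of_forall fun s ↦ hc_eq (q.1, s) hq)
    simp only [hint]
    exact (chartMetric_chartVec hq _ _).symm
  choose ψ hψ hψ_eq using hlocal
  obtain ⟨C, hC, hcover⟩ := TopologicalSpace.countable_cover_nhds
    (fun p : M ↦ (chartAt E p).open_source.mem_nhds (mem_chart_source E p))
  intro B hB
  have : φ ⁻¹' B = ⋃ p ∈ C, ((fun q : X × S ↦ (q.1 : M)) ⁻¹' (chartAt E p).source) ∩ ψ p ⁻¹' B := by
    ext q
    simp only [mem_preimage, mem_iUnion, mem_inter_iff, exists_prop]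
    constructor
    · intro hq
      have : (q.1 : M) ∈ ⋃ p ∈ C, (chartAt E p).source := hcover ▸ mem_univ _
      simp only [mem_iUnion, exists_prop] at this
      obtain ⟨p, hp, hqp⟩ := this
      exact ⟨p, hp, hqp, hψ_eq p q hqp ▸ hq⟩
    · rintro ⟨p, -, hqp, hq⟩
      exact (hψ_eq p q hqp).symm ▸ hq
  rw [this]
  exact .biUnion hC fun p _ ↦
    ((measurable_subtype_coe.comp measurable_fst) (chartAt E p).open_source.measurableSet).inter
      (hψ p hB)

end Measurability

/-! ### Expectations over an independent sample -/

section Probability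

/-- If `ξ` has law `P` and is independent of `x`, expectations of `h (x, ξ)` are computed by first
averaging over a fresh sample. -/
lemma integral_comp_of_indepFun {Ω A S : Type*} [MeasurableSpace Ω] [MeasurableSpace A]
    [MeasurableSpace S] {μ : Measure Ω} [IsProbabilityMeasure μ] {P : Measure S}
    [IsProbabilityMeasure P] {x : Ω → A} {ξ : Ω → S} (hx : Measurable x) (hξ : Measurable ξ)
    (hlaw : μ.map ξ = P) (hind : ProbabilityTheory.IndepFun x ξ μ)
    {h : A × S → ℝ} (hh : Measurable h) {C : ℝ}
    (hint : ∀ᵐ w ∂μ, Integrable (fun s ↦ h (x w, s)) P)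
    (hC : ∀ᵐ w ∂μ, ∫ s, ‖h (x w, s)‖ ∂P ≤ C) :
    Integrable (fun w ↦ h (x w, ξ w)) μ ∧ Integrable (fun w ↦ ∫ s, h (x w, s) ∂P) μ ∧
      ∫ w, h (x w, ξ w) ∂μ = ∫ w, ∫ s, h (x w, s) ∂P ∂μ := by
  have hmap : μ.map (fun w ↦ (x w, ξ w)) = (μ.map x).prod P := by
    rw [← hlaw]
    exact (ProbabilityTheory.indepFun_iff_map_prod_eq_prod_map_map hx.aemeasurable
      hξ.aemeasurable).1 hind
  have : IsProbabilityMeasure (μ.map x) := Measure.isProbabilityMeasure_map hx.aemeasurable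
  have hpair : Measurable (fun w ↦ (x w, ξ w)) := hx.prodMk hξ
  have hprod : Integrable h ((μ.map x).prod P) := by
    rw [integrable_prod_iff hh.aestronglyMeasurable]
    constructor
    · rw [ae_map_iff hx.aemeasurable
        (measurableSet_integrable (f := fun a s ↦ h (a, s)) hh.stronglyMeasurable)]
      exact hint
    · have hm : StronglyMeasurable (fun a ↦ ∫ s, ‖h (a, s)‖ ∂P) :=
        hh.norm.stronglyMeasurable.integral_prod_right'
      rw [integrable_map_measure hm.aestronglyMeasurable hx.aemeasurable]
      refine Integrable.of_bound (hm.comp_measurable hx).aestronglyMeasurable C ?_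
      filter_upwards [hC] with w hw
      rw [Function.comp_apply, Real.norm_of_nonneg (integral_nonneg fun _ ↦ norm_nonneg _)]
      exact hw
  have hsec : StronglyMeasurable (fun a ↦ ∫ s, h (a, s) ∂P) :=
    hh.stronglyMeasurable.integral_prod_right'
  refine ⟨?_, ?_, ?_⟩
  · rw [← hmap] at hprod
    exact hprod.comp_measurable hpair
  · exact hprod.integral_prod_left.comp_measurable hx
  · rw [← integral_map hpair.aemeasurable hh.aestronglyMeasurable, hmap, integral_prod _ hprod,
      integral_map hx.aemeasurable hsec.aestronglyMeasurable]

/-- The inner product of `V` with its mean `m` has expectation `‖m‖ ^ 2`, and its absolute value has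
expectation at most the bound `σ ^ 2` on the second moment of `V`. -/
lemma moments_of_memLp_two {F S : Type*} [NormedAddCommGroup F] [InnerProductSpace ℝ F]
    [CompleteSpace F] [MeasurableSpace S] {P : Measure S} [IsProbabilityMeasure P] {V : S → F}
    (hV : MemLp V 2 P) {σ : ℝ} (hσ : ∫ s, ‖V s‖ ^ 2 ∂P ≤ σ ^ 2) :
    Integrable (fun s ↦ ‖V s‖ ^ 2) P ∧
    Integrable (fun s ↦ (inner ℝ (∫ r, V r ∂P) (V s) : ℝ)) P ∧
    ∫ s, (inner ℝ (∫ r, V r ∂P) (V s) : ℝ) ∂P = ‖∫ r, V r ∂P‖ ^ 2 ∧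
    ∫ s, ‖(inner ℝ (∫ r, V r ∂P) (V s) : ℝ)‖ ∂P ≤ σ ^ 2 := by
  have hV1 : Integrable V P := hV.integrable (by norm_num)
  have hV2 : Integrable (fun s ↦ ‖V s‖ ^ 2) P := hV.integrable_norm_pow (by norm_num)
  set m := ∫ r, V r ∂P with hm
  have hI : Integrable (fun s ↦ (inner ℝ m (V s) : ℝ)) P := hV1.const_inner m
  have hmean : ∫ s, (inner ℝ m (V s) : ℝ) ∂P = ‖m‖ ^ 2 := by
    rw [integral_inner hV1, ← hm, real_inner_self_eq_norm_sq]
  have hle : ∀ s, ‖(inner ℝ m (V s) : ℝ)‖ ≤ (‖m‖ ^ 2 + ‖V s‖ ^ 2) / 2 := fun s ↦ by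
    nlinarith [norm_inner_le_norm (𝕜 := ℝ) m (V s), sq_nonneg (‖m‖ - ‖V s‖)]
  have hbound : ∫ s, ‖(inner ℝ m (V s) : ℝ)‖ ∂P ≤ (‖m‖ ^ 2 + ∫ s, ‖V s‖ ^ 2 ∂P) / 2 := by
    refine (integral_mono hI.norm (((integrable_const _).add hV2).div_const 2) hle).trans_eq ?_
    rw [integral_div, integral_add' (integrable_const _) hV2]
    simp
  -- `hmean` and `hbound` give `‖m‖ ^ 2 ≤ (‖m‖ ^ 2 + σ ^ 2) / 2`, whence Jensen's inequality
  have hm2 : ‖m‖ ^ 2 ≤ σ ^ 2 := by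
    have h1 : ‖m‖ ^ 2 ≤ ∫ s, ‖(inner ℝ m (V s) : ℝ)‖ ∂P := by
      rw [← hmean]
      exact (Real.le_norm_self _).trans (norm_integral_le_integral_norm _)
    linarith
  exact ⟨hV2, hI, hmean, by linarith⟩

end Probability

/-! ### Convergence of Riemannian stochastic gradient descent -/

theorem mainTheorem11
    -- a smooth finite-dimensional Riemannian manifold `M`
    {E : Type*} [NormedAddCommGroup E] [NormedSpace ℝ E] [FiniteDimensional ℝ E]
    {M : Type*} [TopologicalSpace M] [T2Space M] [SecondCountableTopology M]
    [ChartedSpace E M] [IsManifold 𝓘(ℝ, E) ∞ M]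
    [RiemannianBundle (fun x : M ↦ TangentSpace 𝓘(ℝ, E) x)]
    [IsContMDiffRiemannianBundle 𝓘(ℝ, E) ∞ E (fun x : M ↦ TangentSpace 𝓘(ℝ, E) x)]
    [MeasurableSpace M] [BorelSpace M]
    -- a geodesically convex set `X` with well-defined inverse exponential map
    (X : Set M) (hX : HasInverseExp E X)
    -- a geodesically `L`-smooth function `f` with gradient `grad`, and a minimizer `xstar`
    (f : M → ℝ) (grad : ∀ x : M, TangentSpace 𝓘(ℝ, E) x) (L : ℝ) (hL : 0 < L)
    (hf : IsGeodesicallySmoothOn L X f grad)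
    (xstar : X) (hstar : ∀ y ∈ X, f xstar ≤ f y)
    -- the stochastic oracle `G x s`, whose sample `s` has law `P`
    {S : Type*} [MeasurableSpace S] (P : Measure S) [IsProbabilityMeasure P]
    (G : ∀ x : M, S → TangentSpace 𝓘(ℝ, E) x)
    (hG : Measurable[_, borel (TangentBundle 𝓘(ℝ, E) M)]
      (fun q : X × S ↦ (⟨(q.1 : M), G q.1 q.2⟩ : TangentBundle 𝓘(ℝ, E) M)))
    (σ : ℝ) (hσ : 0 < σ)
    -- number of steps, initial point and step size
    (T : ℕ) (hT : 1 ≤ T) (x₀ : X) (hx₀ : f x₀ = f xstar → (x₀ : M) ∈ interior X)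
    (c η : ℝ) (hc : c = √(2 * (f x₀ - f xstar) / (L * σ ^ 2))) (hη : η = c / √(T : ℝ))
    -- the iterates `x t` and the samples `ξ t`, each drawn independently of the past
    {Ω : Type*} [mΩ : MeasurableSpace Ω] (μ : Measure Ω) [IsProbabilityMeasure μ]
    (ℱ : Filtration ℕ mΩ) (ξ : ℕ → Ω → S) (x : ℕ → Ω → X)
    (hx : ∀ t, Measurable[ℱ t] (x t))
    (hξ : ∀ t < T, Measurable (ξ t))
    (hlaw : ∀ t < T, μ.map (ξ t) = P)
    (hindep : ∀ t < T, ProbabilityTheory.Indep (MeasurableSpace.comap (ξ t) inferInstance) (ℱ t) μ)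
    -- unbiasedness and second moment of the oracle at the iterates
    (horacle : ∀ t < T, ∀ᵐ w ∂μ,
      MemLp (G (x t w)) 2 P ∧
      ∫ s, G (x t w) s ∂P = grad (x t w) ∧
      ∫ s, ‖G (x t w) s‖ ^ 2 ∂P ≤ σ ^ 2)
    -- stochastic gradient descent
    (hinit : ∀ᵐ w ∂μ, x 0 w = x₀)
    (hstep : ∀ t < T, ∀ᵐ w ∂μ,
      IsExp X (x t w : M) (-(η • G (x t w) (ξ t w))) (x (t + 1) w)) :
    (∀ t < T, Integrable (fun w ↦ ‖grad (x t w)‖ ^ 2) μ) ∧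
    (Finset.range T).inf' (Finset.nonempty_range_iff.mpr (Nat.one_le_iff_ne_zero.mp hT))
        (fun t ↦ ∫ w, ‖grad (x t w)‖ ^ 2 ∂μ)
      ≤ √(2 * (f x₀ - f xstar) * L / T) * σ := by
  have : ∀ y : M, CompleteSpace (TangentSpace 𝓘(ℝ, E) y) := fun y ↦ by
    have : FiniteDimensional ℝ (TangentSpace 𝓘(ℝ, E) y) := inferInstanceAs (FiniteDimensional ℝ E)
    exact FiniteDimensional.complete ℝ _
  have hxm : ∀ t, Measurable (x t) := fun t ↦ (hx t).mono (ℱ.le t) le_rfl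
  set φ : X × S → ℝ := fun q ↦ inner ℝ (∫ s, G q.1 s ∂P) (G q.1 q.2) with hφ
  set ψ : X × S → ℝ := fun q ↦ ‖G q.1 q.2‖ ^ 2 with hψ
  have hφm : Measurable φ := measurable_inner_integral P G hG
  have hψm : Measurable ψ := measurable_norm_sq_of_measurable_tangentBundle hG
  have hmom : ∀ t < T, ∀ᵐ w ∂μ, _ := fun t ht ↦ (horacle t ht).mono fun w hw ↦
    moments_of_memLp_two hw.1 hw.2.2
  have hind : ∀ t < T, ProbabilityTheory.IndepFun (x t) (ξ t) μ := fun t ht ↦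
    (ProbabilityTheory.indep_of_indep_of_le_right (hindep t ht) (hx t).comap_le).symm
  -- the expectations of the two random terms of the descent inequality
  have hφE : ∀ t < T, Integrable (fun w ↦ φ (x t w, ξ t w)) μ ∧
      Integrable (fun w ↦ ‖grad (x t w)‖ ^ 2) μ ∧
      ∫ w, φ (x t w, ξ t w) ∂μ = ∫ w, ‖grad (x t w)‖ ^ 2 ∂μ := by
    intro t ht
    obtain ⟨h1, h2, h3⟩ := integral_comp_of_indepFun (hxm t) (hξ t ht) (hlaw t ht) (hind t ht) hφm
      ((hmom t ht).mono fun w hw ↦ hw.2.1) ((hmom t ht).mono fun w hw ↦ hw.2.2.2)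
    have hae : (fun w ↦ ∫ s, φ (x t w, s) ∂P) =ᵐ[μ] fun w ↦ ‖grad (x t w)‖ ^ 2 := by
      filter_upwards [hmom t ht, horacle t ht] with w hw hw'
      rw [← hw'.2.1]
      exact hw.2.2.1
    exact ⟨h1, h2.congr hae, h3.trans (integral_congr_ae hae)⟩
  have hψE : ∀ t < T, Integrable (fun w ↦ ψ (x t w, ξ t w)) μ ∧
      ∫ w, ψ (x t w, ξ t w) ∂μ ≤ σ ^ 2 := by
    intro t ht
    have hsq : ∀ᵐ w ∂μ, ∫ s, ‖ψ (x t w, s)‖ ∂P ≤ σ ^ 2 := by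
      filter_upwards [horacle t ht] with w hw
      simpa [hψ] using hw.2.2
    obtain ⟨h1, h2, h3⟩ := integral_comp_of_indepFun (hxm t) (hξ t ht) (hlaw t ht) (hind t ht) hψm
      ((hmom t ht).mono fun w hw ↦ hw.1) hsq
    refine ⟨h1, h3.trans_le ?_⟩
    refine (integral_mono_ae h2 (integrable_const (σ ^ 2))
      ((horacle t ht).mono fun w hw ↦ hw.2.2)).trans_eq ?_
    simp
  refine ⟨fun t ht ↦ (hφE t ht).2.1, ?_⟩
  rcases (hstar x₀ x₀.2).eq_or_lt with heq | hlt
  · -- here `η = 0` and the bound is zero, but `x₀` is an interior minimizer, so that the term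
    -- `t = 0` vanishes
    have hgrad : grad x₀ = 0 := hf.1.eq_zero_of_isMinOn (hx₀ heq.symm)
      (isMinOn_iff.2 fun y hy ↦ heq ▸ hstar y hy)
    have hzero : ∫ w, ‖grad (x 0 w)‖ ^ 2 ∂μ = 0 := by
      refine integral_eq_zero_of_ae (hinit.mono fun w hw ↦ ?_)
      refine (congrArg (fun y : X ↦ ‖grad y‖ ^ 2) hw).trans ?_
      simp [hgrad]
    refine (Finset.inf'_le _ (Finset.mem_range.2 hT)).trans ?_
    rw [hzero]
    positivity
  · have hfm : Measurable (fun y : X ↦ f y) := by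
      have hcont : ContinuousOn f X := fun y hy ↦ (hf.1 y hy).continuousWithinAt
      exact hcont.domRestrict.measurable
    -- the descent inequality for the step `v = -η G`, with the mean of the oracle as gradient
    have hdesc : ∀ t < T, ∀ᵐ w ∂μ, f (x (t + 1) w) ≤
        f (x t w) - η * φ (x t w, ξ t w) + L / 2 * η ^ 2 * ψ (x t w, ξ t w) := by
      intro t ht
      filter_upwards [hstep t ht, horacle t ht] with w hw hw'
      refine (hf.le_of_isExp hw).trans_eq ?_
      rw [inner_neg_right, real_inner_smul_right, norm_neg, norm_smul, mul_pow, Real.norm_eq_abs,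
        sq_abs, ← hw'.2.1]
      ring
    have hint : ∀ t ≤ T, Integrable (fun w ↦ f (x t w)) μ := by
      intro t
      induction t with
      | zero =>
        intro _
        exact (integrable_const (f x₀)).congr (hinit.mono fun w hw ↦ by simp [hw])
      | succ t ih =>
        intro ht
        -- `f xstar` bounds `f` from below, the descent inequality from above
        refine integrable_of_le_of_le (hfm.comp (hxm (t + 1))).aestronglyMeasurable
          (.of_forall fun w ↦ hstar _ (x (t + 1) w).2) (hdesc t ht) (integrable_const _) ?_
        exact ((ih (Nat.le_of_succ_le ht)).sub ((hφE t ht).1.const_mul η)).add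
          ((hψE t ht).1.const_mul _)
    have hdescE : ∀ t < T, ∫ w, f (x (t + 1) w) ∂μ ≤ ∫ w, f (x t w) ∂μ
        - η * ∫ w, ‖grad (x t w)‖ ^ 2 ∂μ + L / 2 * η ^ 2 * σ ^ 2 := by
      intro t ht
      have h1 := (hφE t ht).1.const_mul η
      have h2 := (hψE t ht).1.const_mul (L / 2 * η ^ 2)
      have h0 := hint t ht.le
      have hle := integral_mono_ae (hint (t + 1) ht) ((h0.sub h1).add h2) (hdesc t ht)
      rw [integral_add' (h0.sub h1) h2, integral_sub' h0 h1, integral_const_mul,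
        integral_const_mul, (hφE t ht).2.2] at hle
      have := mul_le_mul_of_nonneg_left (hψE t ht).2 (by positivity : 0 ≤ L / 2 * η ^ 2)
      linarith
    set Δ := f x₀ - f xstar with hΔ
    have hΔpos : 0 < Δ := sub_pos.2 hlt
    have hTpos : (0 : ℝ) < T := by exact_mod_cast hT
    set m := (Finset.range T).inf' (Finset.nonempty_range_iff.mpr (Nat.one_le_iff_ne_zero.mp hT))
        (fun t ↦ ∫ w, ‖grad (x t w)‖ ^ 2 ∂μ) with hm
    have hcpos : 0 < c := by
      rw [hc]
      positivity
    have hηpos : 0 < η := by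
      rw [hη]
      positivity
    have hsum : ∀ t ≤ T, ∫ w, f (x t w) ∂μ ≤
        f x₀ - t * (η * m) + t * (L / 2 * η ^ 2 * σ ^ 2) := by
      intro t
      induction t with
      | zero =>
        intro _
        have : ∫ w, f (x 0 w) ∂μ = ∫ _, f x₀ ∂μ :=
          integral_congr_ae (hinit.mono fun w hw ↦ by simp [hw])
        simp [this]
      | succ t ih =>
        intro ht
        have hmt : η * m ≤ η * ∫ w, ‖grad (x t w)‖ ^ 2 ∂μ :=
          mul_le_mul_of_nonneg_left (Finset.inf'_le _ (Finset.mem_range.2 ht)) hηpos.le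
        have h1 := hdescE t ht
        have h2 := ih (Nat.le_of_succ_le ht)
        push_cast
        linarith
    have hlow : f xstar ≤ ∫ w, f (x T w) ∂μ := by
      have := integral_mono (integrable_const (f xstar)) (hint T le_rfl)
        (fun w ↦ hstar _ (x T w).2)
      simpa using this
    have hmain : T * (η * m) ≤ Δ + T * (L / 2 * η ^ 2 * σ ^ 2) := by
      have := hsum T le_rfl
      linarith
    -- the step size balances the two terms on the right
    have hηsq : T * (L * η ^ 2 * σ ^ 2) = 2 * Δ := by
      rw [hη, div_pow, Real.sq_sqrt hTpos.le, hc, Real.sq_sqrt (by positivity)]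
      field_simp
    have hmle : m ≤ L * η * σ ^ 2 := by
      have : (T * η) * m ≤ (T * η) * (L * η * σ ^ 2) := by linarith
      exact le_of_mul_le_mul_left this (by positivity)
    have hrhs : √(2 * Δ * L / T) = L * η * σ := by
      rw [show 2 * Δ * L / T = (L * η * σ) ^ 2 by rw [← hηsq]; field_simp]
      exact Real.sqrt_sq (by positivity)
    rw [hrhs]
    linarith
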